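/- Let $n$ and $q$ be positive integers, and split the $3n$ positions of a string $x\in[q]^{3n}$ into $A=\{1,\dots,n\}$, $B=\{n+1,\dots,2n\}$ and $C=\{2n+1,\dots,3n\}$. A \emph{3-dimensional matching} is a partition of the $3n$ positions into $n$ triples, each containing exactly one element of each of $A$, $B$ and $C$. A \emph{3-shift} is a 3-dimensional matching $\{T_1,\dots,T_n\}$ for which there are $b,c\in\{1,\dots,n\}$ such that $T_i=\{i,\ n+1+((i+b)\bmod n),\ 2n+1+((i+c)\bmod n)\}$ for all $i\in\{1,\dots,n\}$. The \emph{3-matching-sum} problem (respectively, the \emph{3-shift-sum} problem) is the following partial Boolean function on $[q]^{3n}$. An input $x$ is positive if there is a 3-dimensional matching (respectively, a 3-shift) $\mu$ such that $x_a+x_b+x_c\equiv 0\pmod q$ for every triple $\{a,b,c\}\in\mu$. An input $x$ is negative if $x_a+x_b+x_c\not\equiv 0\pmod q$ for all $a\in A$, $b\in B$ and $c\in C$. The task is to decide whether the input is positive or negative, under the promise that it is one of the two. The quantum query complexity of a partial Boolean function is the least number of queries made by a quantum query algorithm (alternating input-independent unitaries on a finite-dimensional space with calls of the input oracle $O_x\colon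 |i\rangle|a\rangle|w\rangle\mapsto|i\rangle|a+x_i \bmod q\rangle|w\rangle$, and followed by a measurement) that gives the correct answer with probability at least $2/3$ on every positive and every negative input. Then the quantum query complexity of both the 3-shift-sum and the 3-matching-sum problem is $O(\sqrt n)$: there is an absolute constant $K$ such that, for all positive integers $n$ and $q$, both complexities are at most $K\sqrt n$. -/

import Mathlib

open Finset
open scoped ENNReal

/-! ### The quantum query model

Inputs are strings of length `N` over the alphabet `[q]`; the letters of `[q]` are regarded as
residues modulo `q`, that is, as elements of `ZMod q`. -/

/-- A decision problem with a promise, i.e. a partial Boolean function, on strings of length `N`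
over the alphabet `ZMod q`: it is `1` on `positive`, `0` on `negative`, undefined elsewhere. -/
structure PartialBoolFun (N q : ℕ) where
  /-- the inputs on which the value is `1` -/
  positive : Set (Fin N → ZMod q)
  /-- the inputs on which the value is `0` -/
  negative : Set (Fin N → ZMod q)
  disjoint : Disjoint positive negative

/-- A quantum query algorithm.  Its Hilbert space is `ℂ^(Fin N) ⊗ ℂ^(ZMod q) ⊗ ℂ^W`: an index
register, an answer register and a finite workspace.  It alternates arbitrary input-independent
unitaries `U 0, …, U T` with `T = queries` calls of the input oracle, and ends with a measurement
in the computational basis; it accepts when the outcome lies in `accept`.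
(The unitaries `U k` with `k > T` are never used.) -/
structure QuantumQueryAlgorithm (N q : ℕ) [NeZero q] where
  /-- labels of the basis states of the workspace -/
  W : Type
  [fintypeW : Fintype W]
  [decEqW : DecidableEq W]
  /-- the number of oracle calls -/
  queries : ℕ
  /-- the initial computational basis state -/
  start : Fin N × ZMod q × W
  /-- the input-independent unitaries -/
  U : ℕ → Matrix.unitaryGroup (Fin N × ZMod q × W) ℂ
  /-- the accepting measurement outcomes -/
  accept : Finset (Fin N × ZMod q × W)

namespace QuantumQueryAlgorithm

attribute [instance] fintypeW decEqW

variable {N q : ℕ} [NeZero q]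

/-- The action of the input oracle `O_x` on computational basis states:
`|i, a, w⟩ ↦ |i, a + x_i, w⟩`. -/
def oraclePerm (W : Type) (x : Fin N → ZMod q) : Equiv.Perm (Fin N × ZMod q × W) where
  toFun s := (s.1, s.2.1 + x s.1, s.2.2)
  invFun s := (s.1, s.2.1 - x s.1, s.2.2)
  left_inv s := by simp
  right_inv s := by simp

/-- The input oracle `O_x`, the linear extension of `oraclePerm` to state vectors. -/
def oracle (W : Type) (x : Fin N → ZMod q) (ψ : Fin N × ZMod q × W → ℂ) :
    Fin N × ZMod q × W → ℂ :=
  fun s => ψ ((oraclePerm W x).symm s)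

/-- The state `U k O_x U (k - 1) O_x ⋯ O_x U 0 |start⟩`, reached after `k` queries. -/
def state (𝒜 : QuantumQueryAlgorithm N q) (x : Fin N → ZMod q) :
    ℕ → (Fin N × ZMod q × 𝒜.W → ℂ)
  | 0 => (𝒜.U 0).1.mulVec (Pi.single 𝒜.start 1)
  | k + 1 => (𝒜.U (k + 1)).1.mulVec (oracle 𝒜.W x (𝒜.state x k))

/-- The probability that the algorithm accepts the input `x`. -/
noncomputable def acceptProb (𝒜 : QuantumQueryAlgorithm N q) (x : Fin N → ZMod q) : ℝ :=
  ∑ s ∈ 𝒜.accept, ‖𝒜.state x 𝒜.queries s‖ ^ 2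

/-- The algorithm computes the partial function `f` with error probability at most `1/3`. -/
def Computes (𝒜 : QuantumQueryAlgorithm N q) (f : PartialBoolFun N q) : Prop :=
  (∀ x ∈ f.positive, 2 / 3 ≤ 𝒜.acceptProb x) ∧ (∀ x ∈ f.negative, 𝒜.acceptProb x ≤ 1 / 3)

end QuantumQueryAlgorithm

/-- The (bounded-error) quantum query complexity of a partial Boolean function: the least number of
queries of a quantum query algorithm that computes it (`⊤` if there were no such algorithm). -/
noncomputable def quantumQueryComplexity {N q : ℕ} [NeZero q] (f : PartialBoolFun N q) : ℕ∞ :=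
  ⨅ (𝒜 : QuantumQueryAlgorithm N q) (_ : 𝒜.Computes f), (𝒜.queries : ℕ∞)

/-! ### The 3-shift-sum and the 3-matching-sum problems

The `3n` positions are numbered from `0`; the groups are `A = {0, …, n-1}`, `B = {n, …, 2n-1}`
and `C = {2n, …, 3n-1}`. -/

section Problems

/-- The `i`-th position of the group `A`. -/
def posA {n : ℕ} (i : Fin n) : Fin (3 * n) := ⟨i, by omega⟩

/-- The `i`-th position of the group `B`. -/
def posB {n : ℕ} (i : Fin n) : Fin (3 * n) := ⟨n + i, by omega⟩

/-- The `i`-th position of the group `C`. -/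
def posC {n : ℕ} (i : Fin n) : Fin (3 * n) := ⟨2 * n + i, by omega⟩

/-- The group `A` of positions. -/
def groupA (n : ℕ) : Finset (Fin (3 * n)) := univ.image posA

/-- The group `B` of positions. -/
def groupB (n : ℕ) : Finset (Fin (3 * n)) := univ.image posB

/-- The group `C` of positions. -/
def groupC (n : ℕ) : Finset (Fin (3 * n)) := univ.image posC

/-- A 3-dimensional matching: a partition of the `3n` positions into `n` triples, each of which
has exactly one element in each of `A`, `B`, `C`. -/
def IsThreeMatching {n : ℕ} (μ : Finpartition (univ : Finset (Fin (3 * n)))) : Prop :=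
  #μ.parts = n ∧ ∀ T ∈ μ.parts,
    #T = 3 ∧ #(T ∩ groupA n) = 1 ∧ #(T ∩ groupB n) = 1 ∧ #(T ∩ groupC n) = 1

/-- A 3-shift: a 3-dimensional matching whose triples are the `{A_i, B_(i+b), C_(i+c)}` for some
fixed `b` and `c`, where the additions in `Fin n` are modulo `n`. -/
def IsThreeShift {n : ℕ} (μ : Finpartition (univ : Finset (Fin (3 * n)))) : Prop :=
  IsThreeMatching μ ∧ ∃ b c : Fin n,
    μ.parts = univ.image fun i : Fin n => {posA i, posB (i + b), posC (i + c)}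

/-- The string `x` is of the form `μ`: in every triple of `μ` the entries of `x` sum to a multiple
of `q`. -/
def OfForm {n q : ℕ} (x : Fin (3 * n) → ZMod q)
    (μ : Finpartition (univ : Finset (Fin (3 * n)))) : Prop :=
  ∀ T ∈ μ.parts, ∑ j ∈ T, x j = 0

/-- The negative inputs of both problems: no element of `A`, element of `B` and element of `C`
have entries that sum to a multiple of `q`. -/
def negativeInputs (n q : ℕ) : Set (Fin (3 * n) → ZMod q) :=
  {x | ∀ a ∈ groupA n, ∀ b ∈ groupB n, ∀ c ∈ groupC n, x a + x b + x c ≠ 0}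

theorem OfForm.notMem_negativeInputs {n q : ℕ} [NeZero n] {x : Fin (3 * n) → ZMod q}
    {μ : Finpartition (univ : Finset (Fin (3 * n)))} (hμ : IsThreeMatching μ) (h : OfForm x μ) :
    x ∉ negativeInputs n q := by
  intro hx
  have hne : μ.parts.Nonempty := by
    rw [← Finset.card_pos, hμ.1]
    exact Nat.pos_of_ne_zero (NeZero.ne n)
  obtain ⟨T, hT⟩ := hne
  obtain ⟨h3, hA, hB, hC⟩ := hμ.2 T hT
  obtain ⟨a, ha⟩ := Finset.card_eq_one.mp hA
  obtain ⟨b, hb⟩ := Finset.card_eq_one.mp hB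
  obtain ⟨c, hc⟩ := Finset.card_eq_one.mp hC
  have ha' := Finset.mem_inter.mp (ha ▸ Finset.mem_singleton_self a)
  have hb' := Finset.mem_inter.mp (hb ▸ Finset.mem_singleton_self b)
  have hc' := Finset.mem_inter.mp (hc ▸ Finset.mem_singleton_self c)
  have hab : a ≠ b := by
    rintro rfl
    obtain ⟨i, -, hi⟩ := Finset.mem_image.mp ha'.2
    obtain ⟨j, -, hj⟩ := Finset.mem_image.mp hb'.2
    have := congrArg Fin.val (hi.trans hj.symm)
    simp only [posA, posB] at this
    omega
  have hac : a ≠ c := by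
    rintro rfl
    obtain ⟨i, -, hi⟩ := Finset.mem_image.mp ha'.2
    obtain ⟨j, -, hj⟩ := Finset.mem_image.mp hc'.2
    have := congrArg Fin.val (hi.trans hj.symm)
    simp only [posA, posC] at this
    omega
  have hbc : b ≠ c := by
    rintro rfl
    obtain ⟨i, -, hi⟩ := Finset.mem_image.mp hb'.2
    obtain ⟨j, -, hj⟩ := Finset.mem_image.mp hc'.2
    have := congrArg Fin.val (hi.trans hj.symm)
    simp only [posB, posC] at this
    omega
  have hTeq : ({a, b, c} : Finset (Fin (3 * n))) = T := by
    apply Finset.eq_of_subset_of_card_le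
    · intro j hj
      simp only [Finset.mem_insert, Finset.mem_singleton] at hj
      rcases hj with rfl | rfl | rfl
      · exact ha'.1
      · exact hb'.1
      · exact hc'.1
    · rw [h3, Finset.card_eq_three.mpr ⟨a, b, c, hab, hac, hbc, rfl⟩]
  have hsum := h T hT
  rw [← hTeq, Finset.sum_insert (by simp [hab, hac]), Finset.sum_pair hbc, ← add_assoc] at hsum
  exact hx a ha'.2 b hb'.2 c hc'.2 hsum

/-- The 3-matching-sum problem. -/
def threeMatchingSum (n q : ℕ) [NeZero n] : PartialBoolFun (3 * n) q where
  positive := {x | ∃ μ : Finpartition (univ : Finset (Fin (3 * n))),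
    IsThreeMatching μ ∧ OfForm x μ}
  negative := negativeInputs n q
  disjoint := Set.disjoint_left.mpr fun _ ⟨_, hμ, h⟩ => h.notMem_negativeInputs hμ

/-- The 3-shift-sum problem. -/
def threeShiftSum (n q : ℕ) [NeZero n] : PartialBoolFun (3 * n) q where
  positive := {x | ∃ μ : Finpartition (univ : Finset (Fin (3 * n))),
    IsThreeShift μ ∧ OfForm x μ}
  negative := negativeInputs n q
  disjoint := Set.disjoint_left.mpr fun _ ⟨_, hμ, h⟩ => h.notMem_negativeInputs hμ.1

end Problems

/-! ### Unitary matrices -/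

section Unitaries

open Matrix

variable {X : Type*} [Fintype X] [DecidableEq X]

/-! Let `k = ⌈√n⌉`. Read `k` fixed positions of `B` and `2k` uniformly random positions of `A`,
drawn with replacement, and then search `C` for an entry completing a sampled pair to a zero sum. On
a negative input nothing can be found. On a positive input the `k` positions of `B` have `k`
distinct partners in `A`. Since `k² ≥ n`, the sample misses all of them with probability at most `(1
- k/n)^(2k) ≤ 1/4` (`three_quarters_hit`). Once a partner is hit, the third element of its triple is
a target of the search. A 3-shift is a 3-matching and the negative inputs agree, so one algorithm
serves both problems.

The search (`realizes_search`) needs no knowledge of the number of targets. Let `u` be the uniform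
state and `G` the Grover iteration. Run `G ^ t` for a superposition of all `t < M` and test whether
the state differs from the initial one; the acceptance probability is `1 - |(1/M) ∑ ⟨u, G ^ t u⟩|²`.
Without targets `G u = u` and this is `0`. With targets the sum telescopes and is at most `√N` in
modulus (`norm_sum_overlap_le`), which leaves an error of at most `N / M²`.

Random choices and reading are implemented coherently by `Realizes.average` and
`Realizes.read_many`, both based on `realizes_of_prefix`: algorithms run on orthogonal parts of the
workspace do not interfere. -/

theorem exists_unitary_mulVec_single (s : X) (v : X → ℂ) (hv : ∑ i, ‖v i‖ ^ 2 = 1) :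
    ∃ V : unitaryGroup X ℂ, V.1 *ᵥ Pi.single s 1 = v := by
  have hn : ‖(WithLp.toLp 2 v : EuclideanSpace ℂ X)‖ = 1 := by
    rw [EuclideanSpace.norm_eq, hv, Real.sqrt_one]
  have ho : Orthonormal ℂ (({s} : Set X).domRestrict
      fun _ : X => (WithLp.toLp 2 v : EuclideanSpace ℂ X)) := by
    refine ⟨fun _ => hn, fun i j hij => (hij (Subsingleton.elim i j)).elim⟩
  -- Completing `v`, placed at index `s`, to an orthonormal basis gives a unitary change-of-basis
  -- matrix whose column `s` is `v`.
  obtain ⟨b, hb⟩ := ho.exists_orthonormalBasis_extension_of_card_eq (by simp)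
  refine ⟨⟨_, (EuclideanSpace.basisFun X ℂ).toMatrix_orthonormalBasis_mem_unitary b⟩, ?_⟩
  ext i
  have := hb s rfl
  simp [Module.Basis.toMatrix_apply, this]

theorem sum_norm_sq_unitary_mulVec (V : unitaryGroup X ℂ) (v : X → ℂ) :
    ∑ i, ‖(V.1 *ᵥ v) i‖ ^ 2 = ∑ i, ‖v i‖ ^ 2 := by
  have key : ∀ w : X → ℂ, ((∑ i, ‖w i‖ ^ 2 : ℝ) : ℂ) = star w ⬝ᵥ w := fun w => by
    simp [dotProduct, Complex.conj_mul']
  have h : V.1ᴴ * V.1 = 1 := mem_unitaryGroup_iff'.mp V.2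
  apply Complex.ofReal_injective
  rw [key, key, star_mulVec, ← dotProduct_mulVec, mulVec_mulVec, h, one_mulVec]

/-- The unitary that permutes the computational basis by `σ`. -/
noncomputable def permUnitary (σ : Equiv.Perm X) : unitaryGroup X ℂ :=
  ⟨Equiv.Perm.permMatrix ℂ σ.symm, by
    rw [mem_unitaryGroup_iff, star_eq_conjTranspose, conjTranspose_permMatrix, ← permMatrix_mul]
    simp⟩

theorem permUnitary_mulVec (σ : Equiv.Perm X) (ψ : X → ℂ) :
    (permUnitary σ).1 *ᵥ ψ = ψ ∘ σ.symm :=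
  permMatrix_mulVec _

theorem permUnitary_mulVec_single (σ : Equiv.Perm X) (s : X) :
    (permUnitary σ).1 *ᵥ Pi.single s 1 = Pi.single (σ s) 1 := by
  rw [permUnitary_mulVec]
  ext i
  simp [Pi.single_apply, Equiv.symm_apply_eq]

/-- The unitary that flips the sign of the basis states with property `p`. -/
noncomputable def phaseUnitary (p : X → Prop) [DecidablePred p] : unitaryGroup X ℂ :=
  ⟨diagonal fun s => if p s then -1 else 1, by
    rw [mem_unitaryGroup_iff, star_eq_conjTranspose, diagonal_conjTranspose, diagonal_mul_diagonal,
      ← diagonal_one]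
    congr 1
    ext i
    by_cases h : p i <;> simp [h]⟩

theorem phaseUnitary_mulVec (p : X → Prop) [DecidablePred p] (ψ : X → ℂ) (s : X) :
    ((phaseUnitary p).1 *ᵥ ψ) s = if p s then -ψ s else ψ s := by
  simp only [phaseUnitary, mulVec_diagonal]
  split_ifs <;> simp

variable {ι : Type*} [Fintype ι] [DecidableEq ι] {Y : ι → Type*} [∀ k, Fintype (Y k)]
  [∀ k, DecidableEq (Y k)]

/-- The unitary that acts by `u k` on the `k`-th part of the basis. -/
noncomputable def blockUnitary (e : X ≃ Σ k, Y k) (u : ∀ k, unitaryGroup (Y k) ℂ) :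
    unitaryGroup X ℂ :=
  ⟨(blockDiagonal' fun k => (u k).1).submatrix e e, by
    rw [mem_unitaryGroup_iff, star_eq_conjTranspose, conjTranspose_submatrix,
      submatrix_mul_equiv, blockDiagonal'_conjTranspose, ← blockDiagonal'_mul]
    have : (fun k => (u k).1 * (u k).1ᴴ) = fun k => (1 : Matrix (Y k) (Y k) ℂ) :=
      funext fun k => mem_unitaryGroup_iff.mp (u k).2
    rw [this]
    erw [blockDiagonal'_one]
    simp⟩

theorem blockUnitary_mulVec (e : X ≃ Σ k, Y k) (u : ∀ k, unitaryGroup (Y k) ℂ) (ψ : X → ℂ)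
    (s : Σ k, Y k) :
    ((blockUnitary e u).1 *ᵥ ψ) (e.symm s) =
      ((u s.1).1 *ᵥ fun y => ψ (e.symm ⟨s.1, y⟩)) s.2 := by
  obtain ⟨k, y⟩ := s
  simp only [blockUnitary, submatrix_mulVec_equiv, Function.comp_apply, Equiv.apply_symm_apply]
  rw [mulVec, dotProduct, Fintype.sum_sigma, Finset.sum_eq_single k]
  · simp [mulVec, dotProduct, blockDiagonal'_apply_eq]
  · intro j _ hj
    exact Finset.sum_eq_zero fun z _ => by rw [blockDiagonal'_apply_ne _ _ _ hj.symm, zero_mul]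
  · simp

omit [DecidableEq X] in
/-- Every bijection between two families of elements of a finite type extends to a permutation. -/
theorem exists_perm_comp_eq {J : Type*} {f g : J → X} (hf : f.Injective) (hg : g.Injective) :
    ∃ σ : Equiv.Perm X, ∀ j, σ (f j) = g j := by
  classical
  let e : {x // x ∈ Set.range f} ≃ {x // x ∈ Set.range g} :=
    (Equiv.ofInjective f hf).symm.trans (Equiv.ofInjective g hg)
  refine ⟨e.extendSubtype, fun j => ?_⟩
  have : (⟨f j, ⟨j, rfl⟩⟩ : {x // x ∈ Set.range f}) = Equiv.ofInjective f hf j := rfl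
  rw [e.extendSubtype_apply_of_mem _ ⟨j, rfl⟩, this]
  simp only [e, Equiv.trans_apply, Equiv.symm_apply_apply]
  rfl

end Unitaries

/-! ### Building query algorithms from simpler ones -/

section Framework

open Matrix QuantumQueryAlgorithm

variable {N q : ℕ}

theorem oracle_single (W : Type) [DecidableEq W] (x : Fin N → ZMod q)
    (s : Fin N × ZMod q × W) :
    oracle W x (Pi.single s 1) = Pi.single (oraclePerm W x s) 1 := by
  ext t
  simp [oracle, Pi.single_apply, Equiv.symm_apply_eq]

variable [NeZero q]

/-- Some quantum query algorithm with `T` queries accepts each input `x` with probability `P x`. -/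
def Realizes (T : ℕ) (P : (Fin N → ZMod q) → ℝ) : Prop :=
  ∃ 𝒜 : QuantumQueryAlgorithm N q, 𝒜.queries = T ∧ ∀ x, 𝒜.acceptProb x = P x

theorem Realizes.quantumQueryComplexity_le {T : ℕ} {P : (Fin N → ZMod q) → ℝ} (h : Realizes T P)
    (f : PartialBoolFun N q) (hpos : ∀ x ∈ f.positive, 2 / 3 ≤ P x)
    (hneg : ∀ x ∈ f.negative, P x ≤ 1 / 3) : quantumQueryComplexity f ≤ T := by
  obtain ⟨𝒜, rfl, h𝒜⟩ := h
  exact iInf₂_le 𝒜 ⟨fun x hx => (hpos x hx).trans_eq (h𝒜 x).symm,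
    fun x hx => (h𝒜 x).trans_le (hneg x hx)⟩

/-! ### Direct sums of workspaces -/

section Glue

variable {ι : Type} {W : ι → Type}

/-- Splitting the basis along the first component of a dependent workspace. -/
def sigmaWorkspaceEquiv (N q : ℕ) (W : ι → Type) :
    (Fin N × ZMod q × (Σ k, W k)) ≃ Σ k, Fin N × ZMod q × W k where
  toFun s := ⟨s.2.2.1, s.1, s.2.1, s.2.2.2⟩
  invFun s := (s.2.1, s.2.2.1, ⟨s.1, s.2.2.2⟩)
  left_inv _ := rfl
  right_inv _ := rfl

/-- The state vector whose restriction to the `k`-th part of the workspace is `c k • ψ k`. -/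
def glueState (c : ι → ℂ) (ψ : ∀ k, Fin N × ZMod q × W k → ℂ) :
    Fin N × ZMod q × (Σ k, W k) → ℂ :=
  fun s => c s.2.2.1 * ψ s.2.2.1 (s.1, s.2.1, s.2.2.2)

omit [NeZero q] in
theorem oracle_glueState (x : Fin N → ZMod q) (c : ι → ℂ)
    (ψ : ∀ k, Fin N × ZMod q × W k → ℂ) :
    oracle (Σ k, W k) x (glueState c ψ) = glueState c fun k => oracle (W k) x (ψ k) :=
  rfl

variable [Fintype ι] [DecidableEq ι] [∀ k, Fintype (W k)] [∀ k, DecidableEq (W k)]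

/-- The unitary that acts by `u k` on the `k`-th part of the workspace. -/
noncomputable def glueUnitary (u : ∀ k, unitaryGroup (Fin N × ZMod q × W k) ℂ) :
    unitaryGroup (Fin N × ZMod q × (Σ k, W k)) ℂ :=
  blockUnitary (sigmaWorkspaceEquiv N q W) u

theorem glueUnitary_mulVec (u : ∀ k, unitaryGroup (Fin N × ZMod q × W k) ℂ) (c : ι → ℂ)
    (ψ : ∀ k, Fin N × ZMod q × W k → ℂ) :
    (glueUnitary u).1 *ᵥ glueState c ψ = glueState c fun k => (u k).1 *ᵥ ψ k := by
  ext s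
  have h := blockUnitary_mulVec (sigmaWorkspaceEquiv N q W) u (glueState c ψ)
    (sigmaWorkspaceEquiv N q W s)
  rw [Equiv.symm_apply_apply] at h
  refine h.trans ?_
  change ((u s.2.2.1).1 *ᵥ (c s.2.2.1 • ψ s.2.2.1)) _ = _
  rw [mulVec_smul]
  rfl

omit [DecidableEq ι] in
theorem sum_norm_sq_glueState (c : ι → ℂ) (ψ : ∀ k, Fin N × ZMod q × W k → ℂ)
    (S : ∀ k, Finset (Fin N × ZMod q × W k)) :
    ∑ s ∈ univ.filter fun s : Fin N × ZMod q × (Σ k, W k) => (s.1, s.2.1, s.2.2.2) ∈ S s.2.2.1,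
      ‖glueState c ψ s‖ ^ 2 = ∑ k, ‖c k‖ ^ 2 * ∑ s ∈ S k, ‖ψ k s‖ ^ 2 := by
  rw [Finset.sum_filter, ← (sigmaWorkspaceEquiv N q W).symm.sum_comp, Fintype.sum_sigma]
  refine Finset.sum_congr rfl fun k _ => ?_
  rw [Finset.mul_sum, ← Fintype.sum_ite_mem (S k)]
  refine Finset.sum_congr rfl fun s _ => ?_
  have hg : ‖glueState c ψ ((sigmaWorkspaceEquiv N q W).symm ⟨k, s⟩)‖ ^ 2 =
      ‖c k‖ ^ 2 * ‖ψ k s‖ ^ 2 := by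
    change ‖c k * ψ k s‖ ^ 2 = _
    rw [norm_mul, mul_pow]
  by_cases h : s ∈ S k
  · exact (if_pos h).trans (hg.trans (if_pos h).symm)
  · exact (if_neg h).trans (if_neg h).symm

end Glue

/-- After `r` preliminary queries that prepare a superposition of the initial states of a family of
algorithms, the whole family can be run in superposition. -/
theorem realizes_of_prefix {ι : Type} [Fintype ι] [DecidableEq ι]
    (𝒜 : ι → QuantumQueryAlgorithm N q) (T r : ℕ) (hT : ∀ k, (𝒜 k).queries = T)
    (c : (Fin N → ZMod q) → ι → ℂ)
    (s₀ : Fin N × ZMod q × (Σ k, (𝒜 k).W))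
    (u : ℕ → unitaryGroup (Fin N × ZMod q × (Σ k, (𝒜 k).W)) ℂ)
    (hu : ∀ x, QuantumQueryAlgorithm.state ⟨_, r, s₀, u, ∅⟩ x r =
      glueState (c x) fun k => Pi.single (𝒜 k).start 1) :
    Realizes (r + T) fun x => ∑ k, ‖c x k‖ ^ 2 * (𝒜 k).acceptProb x := by
  -- At `j = r` the last unitary of the prefix and the first unitaries of the family are merged, as
  -- no query separates them.
  let V : ℕ → unitaryGroup (Fin N × ZMod q × (Σ k, (𝒜 k).W)) ℂ := fun j =>
    if j < r then u j else
      glueUnitary (fun k => (𝒜 k).U (j - r)) * (if j = r then u r else 1)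
  let ℬ : QuantumQueryAlgorithm N q := 
    { W := Σ k, (𝒜 k).W
      queries := r + T
      start := s₀
      U := V
      accept := univ.filter fun s => (s.1, s.2.1, s.2.2.2) ∈ (𝒜 s.2.2.1).accept }
  let 𝒞 : QuantumQueryAlgorithm N q := ⟨Σ k, (𝒜 k).W, r, s₀, u, ∅⟩
  have h1 : ∀ x, ∀ j < r, ℬ.state x j = 𝒞.state x j := by
    intro x j
    induction j with
    | zero => intro h; simp [state, ℬ, 𝒞, V, h]
    | succ j ih =>
      intro h
      simp only [state, ih (by omega)]
      simp [ℬ, 𝒞, V, h]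
  have h2 : ∀ x, ℬ.state x r =
      (glueUnitary fun k => (𝒜 k).U 0).1 *ᵥ 𝒞.state x r := by
    intro x
    rcases r with _ | r
    · simp [state, ℬ, 𝒞, V, -mulVec_single]
    · simp only [state, h1 x r (by omega)]
      simp [ℬ, 𝒞, V]
  have h3 : ∀ x j, ℬ.state x (r + j) = glueState (c x) fun k => (𝒜 k).state x j := by
    intro x j
    induction j with
    | zero =>
      rw [add_zero, h2, hu, glueUnitary_mulVec]
      rfl
    | succ j ih =>
      rw [← add_assoc, state, ih]
      erw [oracle_glueState]
      have : ℬ.U (r + j + 1) = glueUnitary fun k => (𝒜 k).U (j + 1) := by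
        simp [ℬ, V, show ¬ r + j + 1 < r by omega, show ¬ r + j + 1 = r by omega,
          show r + j + 1 - r = j + 1 by omega]
      rw [this]
      erw [glueUnitary_mulVec]
      rfl
  refine ⟨ℬ, rfl, fun x => ?_⟩
  rw [acceptProb, h3 x T]
  erw [sum_norm_sq_glueState (c x) (fun k => (𝒜 k).state x T) fun k => (𝒜 k).accept]
  refine Finset.sum_congr rfl fun k _ => ?_
  rw [acceptProb, hT]

/-- The average of the acceptance probabilities of a family of algorithms is realizable. -/
theorem Realizes.average {ι : Type} [Fintype ι] [Nonempty ι] {T : ℕ}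
    {P : ι → (Fin N → ZMod q) → ℝ} (h : ∀ k, Realizes T (P k)) :
    Realizes T fun x => (∑ k, P k x) / Fintype.card ι := by
  classical
  choose 𝒜 hT hP using h
  let s₀ : Fin N × ZMod q × (Σ k, (𝒜 k).W) :=
    let k := Classical.arbitrary ι
    ((𝒜 k).start.1, (𝒜 k).start.2.1, ⟨k, (𝒜 k).start.2.2⟩)
  -- Equal amplitudes, whose squares are the uniform weights; preparing this superposition takes no
  -- query.
  let a : ℂ := ((√(Fintype.card ι : ℝ))⁻¹ : ℝ)
  have ha : ‖a‖ ^ 2 = (Fintype.card ι : ℝ)⁻¹ := by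
    rw [Complex.norm_real, Real.norm_eq_abs, sq_abs, inv_pow, Real.sq_sqrt (by positivity)]
  have hv : ∑ s, ‖glueState (fun _ => a)
      (fun k => (Pi.single (𝒜 k).start 1 : Fin N × ZMod q × (𝒜 k).W → ℂ)) s‖ ^ 2 = 1 := by
    have := sum_norm_sq_glueState (fun _ => a)
      (fun k => (Pi.single (𝒜 k).start 1 : Fin N × ZMod q × (𝒜 k).W → ℂ)) fun _ => univ
    simp only [mem_univ, filter_true] at this
    rw [this]
    simp [ha, Pi.single_apply, apply_ite]
  obtain ⟨V, hV⟩ := exists_unitary_mulVec_single s₀ _ hv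
  have := realizes_of_prefix 𝒜 T 0 hT (fun _ _ => a) s₀ (fun _ => V) fun x => hV
  simpa [ha, hP, ← Finset.mul_sum, div_eq_inv_mul] using this

/-- An algorithm may be chosen according to the value of one position of the input, which costs one
query. -/
theorem Realizes.read {T : ℕ} {P : ZMod q → (Fin N → ZMod q) → ℝ}
    (h : ∀ a, Realizes T (P a)) (i : Fin N) :
    Realizes (T + 1) fun x => P (x i) x := by
  choose 𝒜 hT hP using h
  let w : Σ a, (𝒜 a).W := ⟨0, (𝒜 0).start.2.2⟩
  -- The query turns `(i, 0, w)` into `(i, x i, w)`; `σ` then moves `(i, a, w)` to the initial state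
  -- of the algorithm chosen for the value `a`.
  obtain ⟨σ, hσ⟩ := exists_perm_comp_eq (X := Fin N × ZMod q × (Σ a, (𝒜 a).W))
    (f := fun a => (i, a, w))
    (g := fun a => ((𝒜 a).start.1, (𝒜 a).start.2.1, ⟨a, (𝒜 a).start.2.2⟩))
    (fun a b hab => by simpa using hab)
    (fun a b hab => congrArg (fun s => s.2.2.1) hab)
  have := realizes_of_prefix 𝒜 T 1 hT (fun x => Pi.single (x i) 1) (i, 0, w)
    (fun j => if j = 0 then 1 else permUnitary σ) fun x => by
      simp only [state, zero_add, one_ne_zero, if_true, if_false, OneMemClass.coe_one, one_mulVec]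
      rw [oracle_single, permUnitary_mulVec_single]
      have : oraclePerm (Σ a, (𝒜 a).W) x (i, 0, w) = (i, x i, w) := by simp [oraclePerm]
      rw [this, hσ]
      ext ⟨j, b, a, v⟩
      by_cases hax : a = x i
      · subst hax
        simp [glueState, Pi.single_apply, Prod.ext_iff]
      · simp [glueState, Pi.single_apply, Prod.ext_iff, hax]
  rw [add_comm] at this
  simpa [hP, Pi.single_apply, apply_ite] using this

/-- An algorithm may be chosen according to the values of `m` positions of the input, which costs
`m` queries. -/
theorem Realizes.read_many {T m : ℕ} (p : Fin m → Fin N)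
    {P : (Fin m → ZMod q) → (Fin N → ZMod q) → ℝ} (h : ∀ y, Realizes T (P y)) :
    Realizes (T + m) fun x => P (x ∘ p) x := by
  induction m with
  | zero =>
    have : (fun x => P (x ∘ p) x) = P default :=
      funext fun x => congrArg (P · x) (Subsingleton.elim _ _)
    exact this ▸ h default
  | succ m ih =>
    have := Realizes.read (P := fun a x => P (Fin.cons a (x ∘ p ∘ Fin.succ)) x)
      (fun a => ih (p ∘ Fin.succ) (P := fun y => P (Fin.cons a y)) fun y => h _) (p 0)
    have hP : (fun x => P (x ∘ p) x) =
        fun x => P (Fin.cons (x (p 0)) (x ∘ p ∘ Fin.succ)) x :=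
      funext fun x => congrArg (P · x) (by ext j; refine Fin.cases ?_ (fun _ => ?_) j <;> simp)
    exact hP ▸ this

end Framework

/-! ### Quantum search -/

section Search

open Matrix QuantumQueryAlgorithm

variable {N : ℕ} [NeZero N]

/-- The uniform superposition of the positions. -/
noncomputable def uniformState (N : ℕ) : Fin N → ℂ := fun _ => ((√(N : ℝ))⁻¹ : ℝ)

theorem sq_inv_sqrt (N : ℕ) : (((√(N : ℝ))⁻¹ : ℝ) : ℂ) * ((√(N : ℝ))⁻¹ : ℝ) = (N : ℂ)⁻¹ := by
  rw [← Complex.ofReal_mul, ← mul_inv, Real.mul_self_sqrt (by positivity)]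
  simp

theorem norm_inv_sqrt_sq (N : ℕ) : ‖(((√(N : ℝ))⁻¹ : ℝ) : ℂ)‖ ^ 2 = (N : ℝ)⁻¹ := by
  rw [Complex.norm_real, Real.norm_eq_abs, sq_abs, inv_pow, Real.sq_sqrt (by positivity)]

theorem sum_norm_sq_uniformState : ∑ i, ‖uniformState N i‖ ^ 2 = 1 := by
  have : (N : ℝ) ≠ 0 := NeZero.ne _
  simp only [uniformState, norm_inv_sqrt_sq]
  simp [this]

/-- The reflection through the uniform superposition. -/
noncomputable def diffusion (N : ℕ) [NeZero N] : unitaryGroup (Fin N) ℂ :=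
  ⟨(Matrix.of fun _ _ => 2 / (N : ℂ)) - 1, by
    have hN : (N : ℂ) ≠ 0 := NeZero.ne _
    have h : (Matrix.of fun _ _ => 2 / (N : ℂ) : Matrix (Fin N) (Fin N) ℂ) *
        (Matrix.of fun _ _ => 2 / (N : ℂ)) = (Matrix.of fun _ _ => 2 / (N : ℂ)) +
          (Matrix.of fun _ _ => 2 / (N : ℂ)) := by
      ext i j
      simp only [mul_apply, of_apply, Matrix.add_apply, sum_const, card_univ, Fintype.card_fin,
        nsmul_eq_mul]
      field_simp
      norm_num
    have h' : (Matrix.of fun _ _ => 2 / (N : ℂ) : Matrix (Fin N) (Fin N) ℂ)ᴴ =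
        Matrix.of fun _ _ => 2 / (N : ℂ) := by
      ext i j
      simp
    rw [mem_unitaryGroup_iff, star_eq_conjTranspose, conjTranspose_sub, h', conjTranspose_one,
      sub_mul, mul_sub, h]
    simp⟩

theorem diffusion_mulVec (v : Fin N → ℂ) (i : Fin N) :
    ((diffusion N).1 *ᵥ v) i = 2 / N * ∑ j, v j - v i := by
  simp only [diffusion, sub_mulVec, one_mulVec, Pi.sub_apply]
  simp [mulVec, dotProduct, Finset.mul_sum]

/-- One iteration of quantum search for the elements of `S`. -/
noncomputable def searchIter (S : Finset (Fin N)) : unitaryGroup (Fin N) ℂ :=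
  diffusion N * phaseUnitary (· ∈ S)

theorem searchIter_mulVec (S : Finset (Fin N)) (v : Fin N → ℂ) :
    (searchIter S).1 *ᵥ v =
      (diffusion N).1 *ᵥ fun i => if i ∈ S then -v i else v i := by
  rw [searchIter, Submonoid.coe_mul, ← mulVec_mulVec]
  congr 1
  ext i
  rw [phaseUnitary_mulVec]

theorem searchIter_empty_mulVec_uniformState :
    (searchIter (∅ : Finset (Fin N))).1 *ᵥ uniformState N = uniformState N := by
  have hN : (N : ℂ) ≠ 0 := NeZero.ne _
  ext i
  rw [searchIter_mulVec, diffusion_mulVec]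
  simp only [notMem_empty, if_false, uniformState, sum_const, card_univ, Fintype.card_fin,
        nsmul_eq_mul]
  field_simp
  ring

theorem norm_star_dotProduct_le {X : Type*} [Fintype X] (v w : X → ℂ) :
    ‖star v ⬝ᵥ w‖ ≤ √(∑ i, ‖v i‖ ^ 2) * √(∑ i, ‖w i‖ ^ 2) := by
  have := norm_inner_le_norm (𝕜 := ℂ) (WithLp.toLp 2 v : EuclideanSpace ℂ X) (WithLp.toLp 2 w)
  rwa [EuclideanSpace.inner_eq_star_dotProduct, EuclideanSpace.norm_eq, EuclideanSpace.norm_eq,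
    dotProduct_comm] at this

theorem sum_norm_sq_searchIter_pow (S : Finset (Fin N)) (v : Fin N → ℂ) (t : ℕ) :
    ∑ i, ‖((searchIter S).1 ^ t *ᵥ v) i‖ ^ 2 = ∑ i, ‖v i‖ ^ 2 := by
  have := sum_norm_sq_unitary_mulVec (searchIter S ^ t) v
  simpa using this

/-- If `v - G v = u`, then `∑ G ^ t u` over `t < M` telescopes to `v - G ^ M v`, of norm at most
`2‖v‖`. Such a `v` exists with `‖v‖ ≤ √N / 2`, so the bound does not depend on `M`. -/
theorem norm_sum_overlap_le {S : Finset (Fin N)} (hS : S.Nonempty) (M : ℕ) :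
    ‖∑ t ∈ range M, star (uniformState N) ⬝ᵥ ((searchIter S).1 ^ t *ᵥ uniformState N)‖ ≤
      √(N : ℝ) := by
  have hN : (N : ℂ) ≠ 0 := NeZero.ne _
  have hN' : (N : ℝ) ≠ 0 := NeZero.ne _
  have hc : (#S : ℂ) ≠ 0 := Nat.cast_ne_zero.mpr hS.card_pos.ne'
  have hc' : (1 : ℝ) ≤ #S := by exact_mod_cast hS.card_pos
  -- On vectors supported on `S` the phase flip is negation, so `G v` is `v` minus twice the mean of
  -- `v`. The factor `N / (2 * #S)` makes this correction equal to `u`.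
  let v : Fin N → ℂ := fun i =>
    if i ∈ S then ((√(N : ℝ))⁻¹ : ℝ) * ((N / (2 * #S) : ℝ) : ℂ) else 0
  have hv : (searchIter S).1 *ᵥ v = v - uniformState N := by
    ext i
    have h1 : ∀ j, (if j ∈ S then -v j else v j) = -v j := fun j => by
      by_cases hj : j ∈ S <;> simp [v, hj]
    rw [searchIter_mulVec, diffusion_mulVec]
    simp only [h1, Finset.sum_neg_distrib, Pi.sub_apply, uniformState]
    simp only [v, Finset.sum_ite_mem, univ_inter, sum_const, nsmul_eq_mul]
    push_cast
    field_simp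
    ring
  have hsum : ∑ t ∈ range M, (searchIter S).1 ^ t *ᵥ uniformState N =
      v - (searchIter S).1 ^ M *ᵥ v := by
    induction M with
    | zero => simp
    | succ M ih =>
      rw [Finset.sum_range_succ, ih, pow_succ, ← mulVec_mulVec, hv, mulVec_sub]
      abel
  have hnv : √(∑ i, ‖v i‖ ^ 2) ≤ √N / 2 := by
    have h4 : (√(N : ℝ) / 2) = √(N / 4) := by
      rw [Real.sqrt_div (by positivity), show (4 : ℝ) = 2 ^ 2 by norm_num,
        Real.sqrt_sq (by norm_num)]
    rw [h4]
    apply Real.sqrt_le_sqrt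
    have : ∀ i, ‖v i‖ ^ 2 = if i ∈ S then (N : ℝ)⁻¹ * (N / (2 * #S)) ^ 2 else 0 := fun i => by
      by_cases hi : i ∈ S
      · simp only [v, hi, if_true, norm_mul, mul_pow, norm_inv_sqrt_sq]
        rw [Complex.norm_real, Real.norm_eq_abs, sq_abs]
      · simp [v, hi]
    simp only [this, Finset.sum_ite_mem, univ_inter, sum_const, nsmul_eq_mul]
    have : (#S : ℝ) * ((N : ℝ)⁻¹ * (N / (2 * #S)) ^ 2) = N / 4 / #S := by
      field_simp
      norm_num
    rw [this]
    exact div_le_self (by positivity) hc'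
  rw [← dotProduct_sum, hsum, dotProduct_sub]
  refine (norm_sub_le _ _).trans ?_
  have e1 := norm_star_dotProduct_le (uniformState N) v
  have e2 := norm_star_dotProduct_le (uniformState N) ((searchIter S).1 ^ M *ᵥ v)
  rw [sum_norm_sq_searchIter_pow] at e2
  rw [sum_norm_sq_uniformState, Real.sqrt_one, one_mul] at e1 e2
  linarith

/-! ### Search as a query algorithm -/

variable {q : ℕ} [NeZero q]

omit [NeZero N] in
theorem sum_norm_sq_state (𝒜 : QuantumQueryAlgorithm N q) (x : Fin N → ZMod q) (k : ℕ) :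
    ∑ s, ‖𝒜.state x k s‖ ^ 2 = 1 := by
  induction k with
  | zero =>
    rw [state, sum_norm_sq_unitary_mulVec]
    simp [Pi.single_apply, apply_ite]
  | succ k ih =>
    rw [state, sum_norm_sq_unitary_mulVec, ← ih]
    exact (oraclePerm 𝒜.W x).symm.sum_comp fun s => ‖𝒜.state x k s‖ ^ 2

theorem star_unitary_mulVec_apply {X : Type*} [Fintype X] [DecidableEq X] (V : unitaryGroup X ℂ)
    (ψ : X → ℂ) (s : X) : ((star V.1) *ᵥ ψ) s = star (V.1 *ᵥ Pi.single s 1) ⬝ᵥ ψ := by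
  simp [mulVec, dotProduct]

/-- The basis states `(i, a, t)` grouped by the pair `(a, t)`. -/
def positionEquiv (N q M : ℕ) :
    (Fin N × ZMod q × Fin M) ≃ Σ _ : ZMod q × Fin M, Fin N where
  toFun s := ⟨s.2, s.1⟩
  invFun s := (s.2, s.1)
  left_inv _ := rfl
  right_inv _ := rfl

/-- The diffusion on the positions if the counter exceeds `r`, the identity otherwise. -/
noncomputable def controlledDiffusion (N q M r : ℕ) [NeZero N] [NeZero q] :
    unitaryGroup (Fin N × ZMod q × Fin M) ℂ :=
  blockUnitary (positionEquiv N q M) fun b => if r < b.2 then diffusion N else 1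

/-- The sign flip at the basis states with property `f` if the counter exceeds `r`, followed by the
negation of the answer register. -/
noncomputable def controlledPhase (M : ℕ) (f : Fin N → ZMod q → Prop) [∀ i a, Decidable (f i a)]
    (r : ℕ) : unitaryGroup (Fin N × ZMod q × Fin M) ℂ :=
  permUnitary ((Equiv.refl _).prodCongr ((Equiv.neg _).prodCongr (Equiv.refl _))) *
    phaseUnitary fun s => r < s.2.2 ∧ f s.1 s.2.1

omit [NeZero N] in
theorem controlledPhase_mulVec (M : ℕ) (f : Fin N → ZMod q → Prop) [∀ i a, Decidable (f i a)]
    (r : ℕ) (ψ : Fin N × ZMod q × Fin M → ℂ) (i : Fin N) (a : ZMod q) (t : Fin M) :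
    ((controlledPhase M f r).1 *ᵥ ψ) (i, a, t) =
      if r < t ∧ f i (-a) then -ψ (i, -a, t) else ψ (i, -a, t) := by
  rw [controlledPhase, Submonoid.coe_mul, ← mulVec_mulVec, permUnitary_mulVec, Function.comp_apply,
    phaseUnitary_mulVec]
  rfl

theorem controlledDiffusion_mulVec (M r : ℕ) (ψ : Fin N × ZMod q × Fin M → ℂ) (i : Fin N)
    (a : ZMod q) (t : Fin M) :
    ((controlledDiffusion N q M r).1 *ᵥ ψ) (i, a, t) =
      if r < t then ((diffusion N).1 *ᵥ fun j => ψ (j, a, t)) i else ψ (i, a, t) := by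
  have := blockUnitary_mulVec (positionEquiv N q M)
    (fun b => if r < b.2 then diffusion N else 1) ψ ⟨(a, t), i⟩
  refine this.trans ?_
  by_cases h : r < t
  · simp [h, positionEquiv]
  · simp [h, positionEquiv]

/-- The superposition over the counter `t` of the results of the first `min r t` iterations. -/
noncomputable def searchState (q M : ℕ) (S : Finset (Fin N)) (r : ℕ) :
    Fin N × ZMod q × Fin M → ℂ :=
  fun s => if s.2.1 = 0 then
    ((√(M : ℝ))⁻¹ : ℝ) * ((searchIter S).1 ^ min r s.2.2 *ᵥ uniformState N) s.1 else 0

/-- One iteration costs two queries. The first writes `x i`, on which the phase depends; negating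
the register lets the second erase it, so no inverse oracle is needed. Branches with counter `t ≤ r`
have finished and stay fixed. -/
theorem searchState_succ (M : ℕ) (f : Fin N → ZMod q → Prop) [∀ i a, Decidable (f i a)]
    (x : Fin N → ZMod q) (r : ℕ) :
    (controlledDiffusion N q M r).1 *ᵥ oracle (Fin M) x ((controlledPhase M f r).1 *ᵥ
      oracle (Fin M) x (searchState q M (univ.filter fun i => f i (x i)) r)) =
        searchState q M (univ.filter fun i => f i (x i)) (r + 1) := by
  set S : Finset (Fin N) := univ.filter fun i => f i (x i) with hS
  have key : ∀ i a t, oracle (Fin M) x ((controlledPhase M f r).1 *ᵥ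
      oracle (Fin M) x (searchState q M S r)) (i, a, t) =
        if r < t ∧ i ∈ S then -searchState q M S r (i, a, t) else searchState q M S r (i, a, t) := by
    intro i a t
    change ((controlledPhase M f r).1 *ᵥ oracle (Fin M) x (searchState q M S r))
      (i, a - x i, t) = _
    rw [controlledPhase_mulVec]
    have : oracle (Fin M) x (searchState q M S r) (i, -(a - x i), t) =
        searchState q M S r (i, a, t) := by
      change searchState q M S r (i, -(a - x i) - x i, t) = _
      simp [searchState]
    rw [this]
    by_cases ha : a = 0
    · simp [ha, hS]
    · simp [searchState, ha]
  ext ⟨i, a, t⟩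
  rw [controlledDiffusion_mulVec]
  simp only [key]
  by_cases ha : a = 0
  · by_cases ht : r < t
    · have h1 : min r (t : ℕ) = r := min_eq_left ht.le
      have h2 : min (r + 1) (t : ℕ) = r + 1 := min_eq_left ht
      simp only [ht, true_and, if_true, searchState, ha, h1, h2]
      rw [pow_succ', ← mulVec_mulVec, searchIter_mulVec, ← smul_eq_mul, ← Pi.smul_apply,
        ← mulVec_smul]
      congr 2
      ext j
      by_cases hj : j ∈ S <;> simp [hj]
    · have h1 : min r (t : ℕ) = t := min_eq_right (not_lt.mp ht)
      have h2 : min (r + 1) (t : ℕ) = t := min_eq_right (by omega)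
      simp only [ht, false_and, if_false, searchState, h1, h2]
  · by_cases ht : r < t
    · simp [searchState, ha, diffusion_mulVec]
    · simp [searchState, ha, ht]

/-- Branches with different counters are orthogonal, and after `M` rounds branch `t < M` has made
exactly `t` iterations. Hence the overlap is an average over `t`. -/
theorem star_searchState_zero_dotProduct (M : ℕ) (S : Finset (Fin N)) :
    star (searchState q M S 0) ⬝ᵥ searchState q M S M =
      (∑ t ∈ range M, star (uniformState N) ⬝ᵥ ((searchIter S).1 ^ t *ᵥ uniformState N)) / M := by
  have hc : (starRingEnd ℂ) (((√(M : ℝ))⁻¹ : ℝ) : ℂ) = ((√(M : ℝ))⁻¹ : ℝ) :=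
    Complex.conj_ofReal _
  rw [dotProduct, Fintype.sum_prod_type]
  simp only [Fintype.sum_prod_type]
  have h : ∀ (i : Fin N) (t : Fin M), ∑ a : ZMod q,
      star (searchState q M S 0) (i, a, t) * searchState q M S M (i, a, t) =
        (star (uniformState N i) * ((searchIter S).1 ^ (t : ℕ) *ᵥ uniformState N) i) / M := by
    intro i t
    rw [Finset.sum_eq_single 0]
    · have h1 : min M (t : ℕ) = t := min_eq_right t.2.le
      simp only [Pi.star_apply, searchState, if_true, h1, Nat.zero_min, pow_zero, one_mulVec]
      rw [star_mul', Complex.star_def, hc, div_eq_mul_inv, ← sq_inv_sqrt]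
      ring
    · intro a _ ha
      simp [searchState, ha]
    · simp
  rw [Finset.sum_congr rfl fun i _ => (Finset.sum_comm.trans (Finset.sum_congr rfl fun t _ => h i t)),
    Finset.sum_comm, ← Fin.sum_univ_eq_sum_range
      (fun t => star (uniformState N) ⬝ᵥ ((searchIter S).1 ^ t *ᵥ uniformState N)), Finset.sum_div]
  simp only [dotProduct, Finset.sum_div, Pi.star_apply]

theorem sum_norm_sq_searchState_zero (M : ℕ) [NeZero M] (S : Finset (Fin N)) :
    ∑ s, ‖searchState q M S 0 s‖ ^ 2 = 1 := by
  have hM : (M : ℝ) ≠ 0 := NeZero.ne _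
  have h : ∀ (i : Fin N) (t : Fin M), ∑ a : ZMod q, ‖searchState q M S 0 (i, a, t)‖ ^ 2 =
      (M : ℝ)⁻¹ * ‖uniformState N i‖ ^ 2 := by
    intro i t
    rw [Finset.sum_eq_single 0]
    · simp only [searchState, if_true, Nat.zero_min, pow_zero, one_mulVec, norm_mul, mul_pow,
        norm_inv_sqrt_sq]
    · intro a _ ha
      simp [searchState, ha]
    · simp
  rw [Fintype.sum_prod_type]
  simp only [Fintype.sum_prod_type]
  rw [Finset.sum_congr rfl fun i _ => (Finset.sum_comm.trans (Finset.sum_congr rfl fun t _ => h i t))]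
  simp [sum_norm_sq_uniformState, hM]

/-- Quantum search, run for a superposition of `M` numbers of iterations and followed by a test
whether the state has changed. -/
theorem realizes_search (M : ℕ) [NeZero M] (f : Fin N → ZMod q → Prop) :
    ∃ P : (Fin N → ZMod q) → ℝ, Realizes (2 * M) P ∧ (∀ x, 0 ≤ P x) ∧
      (∀ x, (∀ i, ¬ f i (x i)) → P x = 0) ∧
      ∀ x i, f i (x i) → 1 - N / (M : ℝ) ^ 2 ≤ P x := by
  classical
  let s₀ : Fin N × ZMod q × Fin M := (0, 0, 0)
  obtain ⟨V, hV⟩ := exists_unitary_mulVec_single s₀ _ (sum_norm_sq_searchState_zero (q := q) M ∅)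
  -- Before any iteration the state does not depend on `S`, so one preparation `V` serves all
  -- inputs.
  have hV' : ∀ S : Finset (Fin N), V.1 *ᵥ Pi.single s₀ 1 = searchState q M S 0 := fun S => by
    rw [hV]
    ext s
    simp [searchState]
  let 𝒜 : QuantumQueryAlgorithm N q := 
    { W := Fin M
      queries := 2 * M
      start := s₀
      -- Round `r` uses the unitaries `2r + 1` (phase) and `2r + 2` (diffusion). The final `star V`
      -- takes the initial superposition back to `s₀`, so an outcome other than `s₀` reveals a
      -- change.
      U := fun k => (if k = 2 * M then star V else 1) *
        (if k = 0 then V else if k % 2 = 1 then controlledPhase M f (k / 2) else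
          controlledDiffusion N q M (k / 2 - 1))
      accept := univ.erase s₀ }
  have hM : M ≠ 0 := NeZero.ne M
  have hU0 : 𝒜.U 0 = V := by simp [𝒜, hM]
  have hU1 : ∀ r, 𝒜.U (2 * r + 1) = controlledPhase M f r := fun r => by
    have h1 : 2 * r + 1 ≠ 2 * M := by omega
    have h2 : (2 * r + 1) / 2 = r := by omega
    simp [𝒜, h1, h2, Nat.add_mod]
  have hU2 : ∀ r, 𝒜.U (2 * r + 1 + 1) =
      (if r + 1 = M then star V else 1) * controlledDiffusion N q M r := fun r => by
    have h1 : 2 * r + 1 + 1 = 2 * M ↔ r + 1 = M := by omega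
    have h2 : (2 * r + 1 + 1) / 2 - 1 = r := by omega
    have h3 : (2 * r + 1 + 1) % 2 = 0 := by omega
    simp [𝒜, h1, h2, h3]
  let S : (Fin N → ZMod q) → Finset (Fin N) := fun x => univ.filter fun i => f i (x i)
  have hlt : ∀ x, ∀ r < M, 𝒜.state x (2 * r) = searchState q M (S x) r := by
    intro x r
    induction r with
    | zero =>
      intro _
      rw [Nat.mul_zero, state, hU0]
      exact hV' _
    | succ r ih =>
      intro h
      change 𝒜.state x (2 * r + 1 + 1) = _
      rw [state, state, ih (by omega), hU1, hU2, if_neg (by omega), one_mul]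
      exact searchState_succ M f x r
  have hfin : ∀ x, 𝒜.state x (2 * M) = star V.1 *ᵥ searchState q M (S x) M := by
    intro x
    obtain ⟨r, rfl⟩ := Nat.exists_eq_succ_of_ne_zero hM
    change 𝒜.state x (2 * r + 1 + 1) = _
    rw [state, state, hlt x r (by omega), hU1, hU2, if_pos rfl, Submonoid.coe_mul,
      ← mulVec_mulVec]
    exact congrArg _ (searchState_succ _ f x r)
  have hP : ∀ x, 𝒜.acceptProb x = 1 - ‖(∑ t ∈ range M, star (uniformState N) ⬝ᵥ
      ((searchIter (S x)).1 ^ t *ᵥ uniformState N)) / M‖ ^ 2 := by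
    intro x
    have h1 := sum_norm_sq_state 𝒜 x (2 * M)
    rw [← Finset.add_sum_erase _ _ (mem_univ s₀)] at h1
    have h2 : 𝒜.acceptProb x = ∑ s ∈ univ.erase s₀, ‖𝒜.state x (2 * M) s‖ ^ 2 := rfl
    rw [h2, ← h1, hfin, star_unitary_mulVec_apply, hV' (S x), star_searchState_zero_dotProduct]
    ring
  have hM' : (0 : ℝ) < M := by exact_mod_cast Nat.pos_of_ne_zero hM
  refine ⟨_, ⟨𝒜, rfl, fun x => rfl⟩, fun x => Finset.sum_nonneg fun s _ => by positivity,
    fun x hx => ?_, fun x i hi => ?_⟩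
  · have hSx : S x = ∅ := by simp [S, hx]
    have hpow : ∀ t, (searchIter (∅ : Finset (Fin N))).1 ^ t *ᵥ uniformState N =
        uniformState N := by
      intro t
      induction t with
      | zero => simp
      | succ t ih => rw [pow_succ, ← mulVec_mulVec, searchIter_empty_mulVec_uniformState, ih]
    have hone : star (uniformState N) ⬝ᵥ uniformState N = 1 := by
      have := sum_norm_sq_uniformState (N := N)
      rw [← Complex.ofReal_inj] at this
      simpa [dotProduct, Complex.conj_mul'] using this
    have hMc : (M : ℂ) ≠ 0 := NeZero.ne _
    rw [hP, hSx]
    simp [hpow, hone, hMc]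
  · have hne : (S x).Nonempty := ⟨i, by simp [S, hi]⟩
    have := norm_sum_overlap_le hne M
    rw [hP, norm_div, div_pow, Complex.norm_natCast]
    gcongr
    calc _ ≤ √(N : ℝ) ^ 2 := by gcongr
      _ = N := Real.sq_sqrt (by positivity)

end Search

/-! ### The algorithm for 3-matching-sum -/

section MatchingSum

/-- Triples are indexed by their element of `B`. Distinct triples are disjoint and each has only one
element of `B`, so its element of `A` determines `j`. -/
theorem OfForm.exists_triples {n q : ℕ} {x : Fin (3 * n) → ZMod q}
    {μ : Finpartition (univ : Finset (Fin (3 * n)))} (hμ : IsThreeMatching μ) (h : OfForm x μ) :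
    ∃ a c : Fin n → Fin n, a.Injective ∧
      ∀ j, x (posA (a j)) + x (posB j) + x (posC (c j)) = 0 := by
  have key : ∀ j : Fin n, ∃ (a c : Fin n) (T : Finset (Fin (3 * n))), T ∈ μ.parts ∧
      posA a ∈ T ∧ posB j ∈ T ∧ x (posA a) + x (posB j) + x (posC c) = 0 := by
    intro j
    obtain ⟨T, hT, hj⟩ := μ.exists_mem (mem_univ (posB j))
    obtain ⟨h3, hA, -, hC⟩ := hμ.2 T hT
    obtain ⟨a', ha'⟩ := Finset.card_pos.mp (hA.symm ▸ Nat.one_pos)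
    obtain ⟨c', hc'⟩ := Finset.card_pos.mp (hC.symm ▸ Nat.one_pos)
    obtain ⟨haT, haA⟩ := Finset.mem_inter.mp ha'
    obtain ⟨hcT, hcC⟩ := Finset.mem_inter.mp hc'
    obtain ⟨a, -, rfl⟩ := Finset.mem_image.mp haA
    obtain ⟨c, -, rfl⟩ := Finset.mem_image.mp hcC
    refine ⟨a, c, T, hT, haT, hj, ?_⟩
    have hab : posA a ≠ posB j := fun e => by
      have := congrArg Fin.val e
      simp only [posA, posB] at this
      omega
    have hac : posA a ≠ posC c := fun e => by
      have := congrArg Fin.val e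
      simp only [posA, posC] at this
      omega
    have hbc : posB j ≠ posC c := fun e => by
      have := congrArg Fin.val e
      simp only [posB, posC] at this
      omega
    have hTeq : ({posA a, posB j, posC c} : Finset (Fin (3 * n))) = T := by
      apply Finset.eq_of_subset_of_card_le
      · simp [Finset.insert_subset_iff, haT, hj, hcT]
      · rw [h3, Finset.card_eq_three.mpr ⟨_, _, _, hab, hac, hbc, rfl⟩]
    have hsum := h T hT
    rwa [← hTeq, Finset.sum_insert (by simp [hab, hac]), Finset.sum_pair hbc, ← add_assoc] at hsum
  choose a c T hT ha hb hsum using key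
  refine ⟨a, c, fun j j' hjj => ?_, hsum⟩
  have hTT : T j = T j' := μ.eq_of_mem_parts (hT j) (hT j') (ha j) (hjj ▸ ha j')
  have hcard := (hμ.2 _ (hT j)).2.2.1
  have := Finset.card_le_one.mp hcard.le (posB j)
    (Finset.mem_inter.mpr ⟨hb j, Finset.mem_image_of_mem _ (mem_univ _)⟩) (posB j')
    (Finset.mem_inter.mpr ⟨hTT ▸ hb j', Finset.mem_image_of_mem _ (mem_univ _)⟩)
  have := congrArg Fin.val this
  simp only [posB] at this
  omega

/-- Bernoulli's inequality: with `d = n - k > 0`, `(1 + k/d)^k ≥ 1 + k²/d ≥ 2`, because `d ≤ n ≤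
k²`. The claim `key` is this with denominators cleared. -/
theorem two_mul_sub_pow_le {n k : ℕ} (hk : 0 < k) (hkn : k ≤ n) (hnk : n ≤ k ^ 2) :
    2 * (n - k) ^ k ≤ n ^ k := by
  obtain ⟨d, rfl⟩ := Nat.exists_eq_add_of_le' hkn
  rw [Nat.add_sub_cancel]
  rcases Nat.eq_zero_or_pos d with rfl | hd
  · simp [hk.ne']
  have key : ∀ j, d ^ j * (d + j * k) ≤ d * (d + k) ^ j := by
    intro j
    induction j with
    | zero => simp
    | succ j ih =>
      calc d ^ (j + 1) * (d + (j + 1) * k) ≤ d ^ j * (d + j * k) * (d + k) := by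
            rw [pow_succ, mul_assoc, mul_assoc]
            exact Nat.mul_le_mul_left _ (by nlinarith [Nat.zero_le (j * k * k)])
        _ ≤ d * (d + k) ^ j * (d + k) := by gcongr
        _ = d * (d + k) ^ (j + 1) := by ring
  refine Nat.le_of_mul_le_mul_left ?_ hd
  calc d * (2 * d ^ k) = d ^ k * (d + d) := by ring
    _ ≤ d ^ k * (d + k * k) := by gcongr; nlinarith
    _ ≤ d * (d + k) ^ k := key k

/-- Among the sequences of `2k` elements of `Fin n` at least three quarters hit a given set of `k`
elements, if `k ≤ n ≤ k²`. -/
theorem three_quarters_hit {n k : ℕ} (hk : 0 < k) (hkn : k ≤ n) (hnk : n ≤ k ^ 2)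
    (S : Finset (Fin n)) (hS : #S = k) :
    (3 / 4 : ℝ) * (n : ℝ) ^ (2 * k) ≤
      #(univ.filter fun ω : Fin (2 * k) → Fin n => ∃ l, ω l ∈ S) := by
  have h1 : #(univ.filter fun ω : Fin (2 * k) → Fin n => ¬ ∃ l, ω l ∈ S) = (n - k) ^ (2 * k) := by
    have : (univ.filter fun ω : Fin (2 * k) → Fin n => ¬ ∃ l, ω l ∈ S) =
        Fintype.piFinset fun _ => Sᶜ := by
      ext ω
      simp [Fintype.mem_piFinset]
    rw [this, Fintype.card_piFinset_const, card_compl, hS, Fintype.card_fin]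
  have h2 := Finset.card_filter_add_card_filter_not (s := (univ : Finset (Fin (2 * k) → Fin n)))
    (fun ω => ∃ l, ω l ∈ S)
  rw [h1, card_univ, Fintype.card_fun, Fintype.card_fin, Fintype.card_fin] at h2
  -- Drawing `2k` rather than `k` samples squares the miss probability bound `1/2`.
  have h3 : 4 * (n - k) ^ (2 * k) ≤ n ^ (2 * k) := by
    have := Nat.pow_le_pow_left (two_mul_sub_pow_le hk hkn hnk) 2
    rw [mul_pow, ← pow_mul, ← pow_mul, mul_comm k 2] at this
    exact this
  have h4 : 3 * n ^ (2 * k) ≤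
      4 * #(univ.filter fun ω : Fin (2 * k) → Fin n => ∃ l, ω l ∈ S) := by omega
  have h5 : (3 : ℝ) * (n : ℝ) ^ (2 * k) ≤
      4 * #(univ.filter fun ω : Fin (2 * k) → Fin n => ∃ l, ω l ∈ S) := by exact_mod_cast h4
  linarith

theorem exists_realizes_matchingSum (n q k : ℕ) [NeZero n] [NeZero q] (hk : 0 < k) (hkn : k ≤ n)
    (hnk : n ≤ k ^ 2) :
    ∃ P : (Fin (3 * n) → ZMod q) → ℝ, Realizes (15 * k) P ∧
      (∀ x ∈ (threeMatchingSum n q).positive, 2 / 3 ≤ P x) ∧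
      ∀ x ∈ (threeMatchingSum n q).negative, P x ≤ 1 / 3 := by
  have : NeZero (3 * n) := ⟨by have := NeZero.ne n; omega⟩
  have : NeZero (6 * k) := ⟨by omega⟩
  let p : (Fin (2 * k) → Fin n) → Fin (k + 2 * k) → Fin (3 * n) := fun ω =>
    Fin.append (fun j => posB (Fin.castLE hkn j)) (fun l => posA (ω l))
  -- The search ranges over all `3n` positions; membership in `C` is part of the condition.
  let f : (Fin (k + 2 * k) → ZMod q) → Fin (3 * n) → ZMod q → Prop := fun y i a =>
    i ∈ groupC n ∧ ∃ (l : Fin (2 * k)) (j : Fin k),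
      y (Fin.natAdd k l) + y (Fin.castAdd (2 * k) j) + a = 0
  choose P hP hP0 hPneg hPpos using fun y => realizes_search (6 * k) (f y)
  have hreal := Realizes.average fun ω => Realizes.read_many (p ω) hP
  rw [show 2 * (6 * k) + (k + 2 * k) = 15 * k by ring] at hreal
  refine ⟨_, hreal, fun x hx => ?_, fun x hx => ?_⟩
  · obtain ⟨μ, hμ, hform⟩ := hx
    obtain ⟨a, c, ha, hsum⟩ := hform.exists_triples hμ
    let S : Finset (Fin n) := univ.image fun j : Fin k => a (Fin.castLE hkn j)
    have hS : #S = k := by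
      refine (card_image_of_injective univ (ha.comp (Fin.castLE_injective hkn))).trans ?_
      rw [card_univ, Fintype.card_fin]
    have hgood : ∀ ω ∈ univ.filter fun ω : Fin (2 * k) → Fin n => ∃ l, ω l ∈ S,
        (11 / 12 : ℝ) ≤ P (x ∘ p ω) x := by
      intro ω hω
      obtain ⟨l, hl⟩ := (Finset.mem_filter.mp hω).2
      obtain ⟨j, -, hj⟩ := Finset.mem_image.mp hl
      refine le_trans ?_ (hPpos (x ∘ p ω) x (posC (c (Fin.castLE hkn j)))
        ⟨Finset.mem_image_of_mem _ (mem_univ _), l, j, ?_⟩)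
      · have hk' : (0 : ℝ) < k := by exact_mod_cast hk
        have hnk' : (n : ℝ) ≤ (k : ℝ) ^ 2 := by exact_mod_cast hnk
        -- The search error is `3n / (36k²)`, and `n ≤ k²`.
        have : ((3 * n : ℕ) : ℝ) / ((6 * k : ℕ) : ℝ) ^ 2 ≤ 1 / 12 := by
          push_cast
          rw [div_le_div_iff₀ (by positivity) (by norm_num)]
          nlinarith
        linarith
      · simp only [Function.comp_apply, p, Fin.append_left, Fin.append_right]
        rw [← hj]
        exact hsum _
    have hn : (0 : ℝ) < (n : ℝ) ^ (2 * k) := by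
      have : (0 : ℝ) < n := by exact_mod_cast Nat.pos_of_ne_zero (NeZero.ne n)
      positivity
    have hcard : (Fintype.card (Fin (2 * k) → Fin n) : ℝ) = (n : ℝ) ^ (2 * k) := by simp
    rw [hcard, le_div_iff₀ hn]
    have h1 := three_quarters_hit hk hkn hnk S hS
    have h2 := Finset.card_nsmul_le_sum _ _ _ hgood
    have h3 := Finset.sum_le_sum_of_subset_of_nonneg
      (Finset.filter_subset (fun ω : Fin (2 * k) → Fin n => ∃ l, ω l ∈ S) univ)
      (fun ω _ _ => hP0 (x ∘ p ω) x)
    rw [nsmul_eq_mul] at h2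
    -- The total is at least `3/4 * 11/12 = 11/16`, which exceeds `2/3`.
    linarith
  · have hzero : ∀ ω, P (x ∘ p ω) x = 0 := fun ω => hPneg _ x fun i hi => by
      obtain ⟨hiC, l, j, h0⟩ := hi
      simp only [Function.comp_apply, p, Fin.append_left, Fin.append_right] at h0
      exact hx _ (Finset.mem_image_of_mem _ (mem_univ _)) _
        (Finset.mem_image_of_mem _ (mem_univ _)) i hiC h0
    simp only [hzero, sum_const_zero, zero_div]
    norm_num

theorem mainTheorem6 :
    ∃ K : ℝ, ∀ (n q : ℕ) [NeZero n] [NeZero q],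
      (quantumQueryComplexity (threeShiftSum n q) : ℝ≥0∞) ≤ ENNReal.ofReal (K * √(n : ℝ)) ∧
      (quantumQueryComplexity (threeMatchingSum n q) : ℝ≥0∞) ≤ ENNReal.ofReal (K * √(n : ℝ)) := by
  -- There are `15 * ⌈√n⌉` queries, and `⌈√n⌉ ≤ √n + 1 ≤ 2√n`.
  refine ⟨30, fun n q _ _ => ?_⟩
  have hn : (1 : ℝ) ≤ n := by exact_mod_cast Nat.one_le_iff_ne_zero.mpr (NeZero.ne n)
  have hs : (1 : ℝ) ≤ √(n : ℝ) := Real.one_le_sqrt.mpr hn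
  have hsq : √(n : ℝ) * √(n : ℝ) = n := Real.mul_self_sqrt (by positivity)
  have hle : √(n : ℝ) ≤ ⌈√(n : ℝ)⌉₊ := Nat.le_ceil _
  have hlt : (⌈√(n : ℝ)⌉₊ : ℝ) < √(n : ℝ) + 1 := Nat.ceil_lt_add_one (by positivity)
  have hk : 0 < ⌈√(n : ℝ)⌉₊ := Nat.ceil_pos.mpr (by linarith)
  have hkn : ⌈√(n : ℝ)⌉₊ ≤ n := Nat.ceil_le.mpr (by nlinarith)
  have hnk : n ≤ ⌈√(n : ℝ)⌉₊ ^ 2 := by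
    have : (n : ℝ) ≤ (⌈√(n : ℝ)⌉₊ : ℝ) ^ 2 := by nlinarith
    exact_mod_cast this
  obtain ⟨P, hP, hpos, hneg⟩ := exists_realizes_matchingSum n q _ hk hkn hnk
  have hbound : ∀ f : PartialBoolFun (3 * n) q,
      quantumQueryComplexity f ≤ ((15 * ⌈√(n : ℝ)⌉₊ : ℕ) : ℕ∞) →
        (quantumQueryComplexity f : ℝ≥0∞) ≤ ENNReal.ofReal (30 * √(n : ℝ)) := by
    intro f hf
    refine (ENat.toENNReal_le.mpr hf).trans ?_
    rw [ENat.toENNReal_coe, ← ENNReal.ofReal_natCast]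
    apply ENNReal.ofReal_le_ofReal
    push_cast
    linarith
  exact ⟨hbound _ (hP.quantumQueryComplexity_le _
      (fun x ⟨μ, hμ, hx⟩ => hpos x ⟨μ, hμ.1, hx⟩) hneg),
    hbound _ (hP.quantumQueryComplexity_le _ hpos hneg)⟩

end MatchingSum
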